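/- Let $d\ge 1$, $X,T,\varepsilon,\delta>0$, $\kappa\ge 2$, $\Omega=(0,X)^d$, and let $B_\delta(0)\subset\mathbb R^d$ be the Euclidean ball. Let $\rho_\delta:[0,\delta]\to[0,\infty)$ satisfy $\int_{B_\delta(0)}|s|^2\rho_\delta(|s|)\,ds=2d$, and put $$\mathcal L_\delta v(x)=\tfrac12\int_{B_\delta(0)}\rho_\delta(|s|)\big(v(x+s)+v(x-s)-2v(x)\big)\,ds .$$ Let $u\in C^2([0,T];C^4_{\rm per}(\overline\Omega))$ be a solution of the nonlocal Allen–Cahn problem $u_t-\varepsilon^2\mathcal L_\delta u+u^3-u=0$ in $\Omega\times(0,T)$, $u(\cdot,t)$ $\Omega$-periodic for $t\in[0,T]$, $u(\cdot,0)=u_0$ on $\overline\Omega$, with $\|u_0\|_{L^\infty}\le 1$. *Discretization.* For an integer $N\ge1$ let $h=X/N$, with mesh nodes $x_i=hi$, $i\in\{0,\dots,N-1\}^d$; grid functions $U\in\mathbb R^{N^d}$ are extended periodically in the index. Let $I^h$ denote restriction to the nodes. Let $\psi_j$, $j\in\mathbb Z^d$, be the piecewise $d$-multilinear nodal basis functions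 of the mesh $h\mathbb Z^d$, let $s_j=hj$, and let $D_h$ be the matrix of the operator $$(\mathcal L_{\delta,h}U)_i=\sum_{0\ne j\in\mathbb Z^d}\frac{U_{i+j}+U_{i-j}-2U_i}{|s_j|^2}\,\|s_j\|_1\,\beta_\delta(s_j),\qquad \beta_\delta(s_j)=\tfrac12\int_{B_\delta(0)}\psi_j(s)\frac{|s|^2}{\|s\|_1}\rho_\delta(|s|)\,ds$$ (a finite sum: $\beta_\delta(s_j)=0$ unless $|j_k|\le\lfloor\delta/h\rfloor+1$ for all $k$). Put $L_h=-\varepsilon^2D_h+\kappa I$ and $f(U)_i=(\kappa+1)U_i-U_i^3$. For an integer $K_t\ge1$ let $\tau=T/K_t$, and let $U^0=I^hu_0$ and, for $0\le n\le K_t-1$ (ETDRK2 scheme), $$\widetilde U^{n+1}=e^{-L_h\tau}U^n+\int_0^\tau e^{-L_h(\tau-s)}f(U^n)\,ds,$$ $$U^{n+1}=e^{-L_h\tau}U^n+\int_0^\tau e^{-L_h(\tau-s)}\Big[\Big(1-\frac s\tau\Big)f(U^n)+\frac s\tau f(\widetilde U^{n+1})\Big]ds .$$ Define the discrete energy $E_h(U)=\frac14\sum_i(U_i^2-1)^2-\frac{\varepsilon^2}{2}U^TD_hU$,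 the sum being over all $N^d$ nodes. **Theorem (energy boundedness of ETDRK2).** 1. There is a constant $\widetilde C>0$, independent of $h$ and $\tau$, such that for all $h=X/N$ and all $\tau=T/K_t\le 1$, $$E_h(U^{n+1})\le E_h(U^n)+\widetilde C\,h^{-1/2}(h^2+\tau)^2,\qquad 0\le n\le K_t-1 .$$ 2. For every $\lambda>0$ there is a constant $\widehat C>0$, independent of $h$ and $\tau$, such that whenever $h=X/N\le 1$ and $\tau=T/K_t=\lambda\sqrt h$, $$E_h(U^n)\le E_h(U^0)+\widehat C,\qquad 0\le n\le K_t .$$ -/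

import Mathlib

open MeasureTheory
open scoped Matrix BoundedContinuousFunction

noncomputable section

namespace NAC

/-- `ℝᵈ` with the Euclidean norm. -/
abbrev E (d : ℕ) : Type := EuclideanSpace ℝ (Fin d)

/-- The lattice point `a • z` of the uniform mesh `a ℤᵈ`. -/
def node {d : ℕ} (a : ℝ) (z : Fin d → ℤ) : E d := WithLp.toLp 2 fun k => a * (z k : ℝ)

/-- The vector `1`-norm `‖s‖₁`. -/
def norm1 {d : ℕ} (s : E d) : ℝ := ∑ k, |s k|

/-- The open cube `Ω = (0, X)ᵈ`. -/
def Omega (d : ℕ) (X : ℝ) : Set (E d) := {x | ∀ k, x k ∈ Set.Ioo 0 X}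

/-- The closed cube, that is, the closure of `Ω`. -/
def OmegaBar (d : ℕ) (X : ℝ) : Set (E d) := {x | ∀ k, x k ∈ Set.Icc 0 X}

/-- `g : ℝᵈ → F` is `Ω`-periodic, i.e. invariant under translation by `X ℤᵈ`. -/
def IsPeriodic {d : ℕ} (X : ℝ) {F : Type*} (g : E d → F) : Prop :=
  ∀ (z : Fin d → ℤ) (x : E d), g (x + node X z) = g x

theorem IsPeriodic.bounded {d : ℕ} {X : ℝ} (hX : 0 < X) {F : Type*} [NormedAddCommGroup F]
    {g : E d → F} (hp : IsPeriodic X g) (hg : Continuous g) : ∃ C : ℝ, ∀ x, ‖g x‖ ≤ C := by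
  have hc : IsCompact ((WithLp.toLp 2 : (Fin d → ℝ) → E d) ''
      Set.pi Set.univ fun _ => Set.Icc (0 : ℝ) X) :=
    (isCompact_univ_pi fun _ => isCompact_Icc).image (PiLp.continuous_toLp 2 _)
  obtain ⟨C, hC⟩ := hc.exists_bound_of_continuousOn hg.continuousOn
  refine ⟨C, fun x => ?_⟩
  rw [← hp (fun k => -⌊x k / X⌋) x]
  refine hC _ ⟨fun k => x k + X * ((-⌊x k / X⌋ : ℤ) : ℝ), fun k _ => ?_, ?_⟩
  · have h1 := Int.floor_le (x k / X)
    have h2 := (Int.lt_floor_add_one (x k / X)).le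
    rw [le_div_iff₀ hX] at h1
    rw [div_le_iff₀ hX] at h2
    push_cast
    constructor <;> nlinarith
  · ext k
    simp [node]

theorem IsPeriodic.iteratedFDeriv {d : ℕ} {X : ℝ} {g : E d → ℝ} (hp : IsPeriodic X g) (k : ℕ) :
    IsPeriodic X (iteratedFDeriv ℝ k g) := by
  intro z x
  rw [← iteratedFDeriv_comp_add_right k (node X z) x]
  congr 1
  exact funext fun y => hp z y

/-- The space of `Ω`-periodic functions of class `C⁴`, as a real vector space. -/
def CPer4 (d : ℕ) (X : ℝ) : Submodule ℝ (E d → ℝ) where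
  carrier := {g | ContDiff ℝ 4 g ∧ IsPeriodic X g}
  zero_mem' := ⟨contDiff_const, fun _ _ => rfl⟩
  add_mem' := fun ha hb =>
    ⟨ha.1.add hb.1, fun z x => congrArg₂ (· + ·) (ha.2 z x) (hb.2 z x)⟩
  smul_mem' := fun c _ ha => ⟨ha.1.const_smul c, fun z x => congrArg (c * ·) (ha.2 z x)⟩

/-- The derivatives `(D⁰ g, …, D⁴ g)` of a periodic `C⁴` function, as bounded continuous maps. -/
def jet (d : ℕ) (X : ℝ) [hX : Fact (0 < X)] :
    CPer4 d X →ₗ[ℝ] ((k : Fin 5) → E d →ᵇ ContinuousMultilinearMap ℝ (fun _ : Fin k => E d) ℝ) where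
  toFun g k := BoundedContinuousFunction.ofNormedAddCommGroup (iteratedFDeriv ℝ k g.1)
    (g.2.1.continuous_iteratedFDeriv (by exact_mod_cast Nat.lt_succ_iff.mp k.2))
    ((g.2.2.iteratedFDeriv k).bounded hX.out
      (g.2.1.continuous_iteratedFDeriv (by exact_mod_cast Nat.lt_succ_iff.mp k.2))).choose
    ((g.2.2.iteratedFDeriv k).bounded hX.out
      (g.2.1.continuous_iteratedFDeriv
        (by exact_mod_cast Nat.lt_succ_iff.mp k.2))).choose_spec
  map_add' f g := by
    funext k
    ext1 x
    have hk : ((k : ℕ) : WithTop ℕ∞) ≤ 4 := by exact_mod_cast Nat.lt_succ_iff.mp k.2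
    exact iteratedFDeriv_add_apply (f.2.1.contDiffAt.of_le hk) (g.2.1.contDiffAt.of_le hk)
  map_smul' c g := by
    funext k
    ext1 x
    have hk : ((k : ℕ) : WithTop ℕ∞) ≤ 4 := by exact_mod_cast Nat.lt_succ_iff.mp k.2
    exact iteratedFDeriv_const_smul_apply (g.2.1.contDiffAt.of_le hk)

theorem jet_injective (d : ℕ) (X : ℝ) [Fact (0 < X)] : Function.Injective (jet d X) := by
  intro f g hfg
  apply Subtype.ext
  funext x
  have h0 := congrArg (fun F => F x) (congrFun hfg 0)
  have h1 : iteratedFDeriv ℝ 0 f.1 x = iteratedFDeriv ℝ 0 g.1 x := h0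
  have h2 := congrArg (fun F => F 0) h1
  simpa using h2

/-- The `C⁴` norm `max_{k ≤ 4} sup_x ‖Dᵏ g (x)‖` on the space of periodic `C⁴` functions. -/
instance instNormedAddCommGroupCPer4 (d : ℕ) (X : ℝ) [Fact (0 < X)] :
    NormedAddCommGroup (CPer4 d X) :=
  NormedAddCommGroup.induced _ _ (jet d X) (jet_injective d X)

instance instNormedSpaceCPer4 (d : ℕ) (X : ℝ) [Fact (0 < X)] : NormedSpace ℝ (CPer4 d X) :=
  NormedSpace.induced ℝ (CPer4 d X) _ (jet d X)

/-- `ρ` (used on `[0, δ]` only) is a nonnegative kernel with horizon `δ` and second moment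
`∫_{B_δ(0)} |s|² ρ(|s|) ds = 2 d`. Since `2 d ≠ 0` for `d ≥ 1`, the integrand is integrable. -/
structure IsKernel (d : ℕ) (δ : ℝ) (ρ : ℝ → ℝ) : Prop where
  nonneg : ∀ r ∈ Set.Icc 0 δ, 0 ≤ ρ r
  second_moment : ∫ s in Metric.ball (0 : E d) δ, ‖s‖ ^ 2 * ρ ‖s‖ = 2 * (d : ℝ)

/-- The nonlocal operator
`(L_δ v)(x) = ½ ∫_{B_δ(0)} ρ(|s|) (v(x + s) + v(x - s) - 2 v(x)) ds`. -/
def nonlocalOp {d : ℕ} (δ : ℝ) (ρ : ℝ → ℝ) (v : E d → ℝ) (x : E d) : ℝ :=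
  1 / 2 * ∫ s in Metric.ball (0 : E d) δ, ρ ‖s‖ * (v (x + s) + v (x - s) - 2 * v x)

/-- `u` solves the nonlocal Allen–Cahn problem `u_t - ε² L_δ u + u³ - u = 0` in `Ω × (0, T)`
with `u(·, 0) = u₀` on the closed cube; spatial periodicity is part of the type of `u`. -/
structure IsNACSolution {d : ℕ} {X : ℝ} (T ε δ : ℝ) (ρ : ℝ → ℝ) (u₀ : E d → ℝ)
    (u : ℝ → CPer4 d X) : Prop where
  equation : ∀ t ∈ Set.Ioo 0 T, ∀ x ∈ Omega d X, ∃ ut : ℝ,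
    HasDerivAt (fun s => (u s).1 x) ut t ∧
      ut - ε ^ 2 * nonlocalOp δ ρ (u t).1 x + (u t).1 x ^ 3 - (u t).1 x = 0
  initial : ∀ x ∈ OmegaBar d X, (u 0).1 x = u₀ x

/-! ### Spatial discretization: periodic grid functions on the mesh of size `h` -/

/-- Indices of the `Nᵈ` mesh nodes of the periodic cube. -/
abbrev Idx (d N : ℕ) : Type := Fin d → ZMod N

/-- Restriction `Iʰ` to the mesh nodes `x_i = h i`, `i ∈ {0, …, N - 1}ᵈ`. -/
def restrict {d : ℕ} (N : ℕ) (h : ℝ) (v : E d → ℝ) : Idx d N → ℝ :=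
  fun i => v (node h fun k => ((i k).val : ℤ))

/-- The piecewise `d`-multilinear basis function `ψ_j` of the node `h j`. -/
def hat {d : ℕ} (h : ℝ) (j : Fin d → ℤ) (s : E d) : ℝ := ∏ k, max 0 (1 - |s k / h - (j k : ℝ)|)

/-- `β_δ(s_j) = ½ ∫_{B_δ(0)} ψ_j(s) (|s|² / ‖s‖₁) ρ(|s|) ds`. -/
def beta {d : ℕ} (δ : ℝ) (ρ : ℝ → ℝ) (h : ℝ) (j : Fin d → ℤ) : ℝ :=
  1 / 2 * ∫ s in Metric.ball (0 : E d) δ, hat h j s * (‖s‖ ^ 2 / norm1 s) * ρ ‖s‖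

/-- The nonzero `j ∈ ℤᵈ` with `|j_k| ≤ r`, `r = ⌊δ / h⌋ + 1`. All `j ≠ 0` for which `ψ_j` does not
vanish identically on `B_δ(0)` are among them. -/
def stencil (d : ℕ) (δ h : ℝ) : Finset (Fin d → ℤ) :=
  (Fintype.piFinset fun _ : Fin d => Finset.Icc (-(⌊δ / h⌋ + 1)) (⌊δ / h⌋ + 1)).erase 0

/-- The quadrature-based difference operator
`(L_{δ,h} U)_i = ∑_{j ≠ 0} (U_{i+j} + U_{i-j} - 2 U_i) / |s_j|² * ‖s_j‖₁ * β_δ(s_j)`, `s_j = h j`,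
where indices are added modulo `N` (periodicity). -/
def discreteOp {d : ℕ} (N : ℕ) (δ : ℝ) (ρ : ℝ → ℝ) (h : ℝ) :
    (Idx d N → ℝ) →ₗ[ℝ] (Idx d N → ℝ) where
  toFun U i := ∑ j ∈ stencil d δ h,
    (U (i + fun k => (j k : ZMod N)) + U (i - fun k => (j k : ZMod N)) - 2 * U i)
      / ‖(node h j : E d)‖ ^ 2 * norm1 (node h j : E d) * beta δ ρ h j
  map_add' U V := by
    funext i
    simp only [Pi.add_apply, ← Finset.sum_add_distrib]
    exact Finset.sum_congr rfl fun j _ => by ring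
  map_smul' c U := by
    funext i
    simp only [Pi.smul_apply, smul_eq_mul, RingHom.id_apply, Finset.mul_sum]
    exact Finset.sum_congr rfl fun j _ => by ring

section Scheme

variable {d : ℕ} (N : ℕ) [NeZero N]

/-- The nonlocal stiffness matrix `D_h`. -/
def stiffness (δ : ℝ) (ρ : ℝ → ℝ) (h : ℝ) : Matrix (Idx d N) (Idx d N) ℝ :=
  LinearMap.toMatrix' (discreteOp N δ ρ h)

/-- `L_h = -ε² D_h + κ I`. -/
def Lh (ε κ δ : ℝ) (ρ : ℝ → ℝ) (h : ℝ) : Matrix (Idx d N) (Idx d N) ℝ :=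
  -(ε ^ 2 • stiffness N δ ρ h) + κ • (1 : Matrix (Idx d N) (Idx d N) ℝ)

variable {N}

/-- `f(U) = (κ + 1) U - U³`, componentwise. -/
def nonlin (κ : ℝ) (U : Idx d N → ℝ) : Idx d N → ℝ := fun i => (κ + 1) * U i - U i ^ 3

/-- First stage `e^{-Lτ} U + ∫₀^τ e^{-L(τ-s)} f(U) ds`. -/
def stage1 (κ τ : ℝ) (L : Matrix (Idx d N) (Idx d N) ℝ) (U : Idx d N → ℝ) : Idx d N → ℝ :=
  NormedSpace.exp (-(τ • L)) *ᵥ U +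
    ∫ s in (0 : ℝ)..τ, NormedSpace.exp (-((τ - s) • L)) *ᵥ nonlin κ U

/-- One ETDRK2 step: with `W` the first stage,
`e^{-Lτ} U + ∫₀^τ e^{-L(τ-s)} [(1 - s/τ) f(U) + (s/τ) f(W)] ds`. -/
def etdrk2Step (κ τ : ℝ) (L : Matrix (Idx d N) (Idx d N) ℝ) (U : Idx d N → ℝ) : Idx d N → ℝ :=
  NormedSpace.exp (-(τ • L)) *ᵥ U +
    ∫ s in (0 : ℝ)..τ, NormedSpace.exp (-((τ - s) • L)) *ᵥ
      ((1 - s / τ) • nonlin κ U + (s / τ) • nonlin κ (stage1 κ τ L U))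

/-- `U⁰, …, U^K` is generated by the ETDRK2 scheme with mesh size `h`, time step `τ` and
`U⁰ = Iʰ u₀`. -/
structure IsETDRK2 (ε κ δ : ℝ) (ρ : ℝ → ℝ) (h τ : ℝ) (K : ℕ) (u₀ : E d → ℝ)
    (U : ℕ → Idx d N → ℝ) : Prop where
  init : U 0 = restrict N h u₀
  step : ∀ n < K, U (n + 1) = etdrk2Step κ τ (Lh N ε κ δ ρ h) (U n)

/-- The discrete energy `E_h(U) = ¼ ∑_i (U_i² - 1)² - (ε²/2) Uᵀ D_h U`. -/
def energy (ε δ : ℝ) (ρ : ℝ → ℝ) (h : ℝ) (U : Idx d N → ℝ) : ℝ :=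
  1 / 4 * ∑ i, (U i ^ 2 - 1) ^ 2 - ε ^ 2 / 2 * (U ⬝ᵥ (stiffness N δ ρ h *ᵥ U))

end Scheme

end NAC

end

/-! ETDRK2 decreases `energy` at every step, for all `h` and `τ`, so both remainders are mere
nonnegative slack and the constant 1 serves in both parts.

On `[-1, 1]` the double well has second derivative `3u² - 1 ≤ 2 ≤ κ`. Taylor's formula for the well
and an exact expansion of the quadratic part bound an energy increment between states in the unit
ball by a quadratic expression in `L_h` (`energy_sub_le`). The states and stages do stay in that
ball: `e^{-tL_h}` shrinks the maximum norm by `e^{-tκ}`, and `f` maps `[-1, 1]` into `[-κ, κ]`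
(`norm_stage1_le_one`, `norm_etdrk2Step_le_one`).

Adding the bounds for `U → W` and `W → V`, with `W` the first stage and `V` the new state, leaves an
expression in the stages and the two nonlinear vectors. Since `L_h` is symmetric and positive
definite, it splits over eigenvectors (`etdrk2_dissipation`), and each mode reduces to a negative
semidefinite quadratic form in the two scalar increments (`etdrk2_mode_dissipation`). -/

namespace NAC

/-! ### Matrix exponentials acting on vectors -/

section MatrixExp

variable {n : Type*} [Fintype n] [DecidableEq n]

theorem hasSum_exp_mulVec (M : Matrix n n ℝ) (v : n → ℝ) :
    HasSum (fun k : ℕ => ((k.factorial : ℝ)⁻¹) • (M ^ k *ᵥ v)) (NormedSpace.exp M *ᵥ v) := by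
  have h : HasSum (fun k : ℕ => ((k.factorial : ℝ)⁻¹) • M ^ k) (NormedSpace.exp M) :=
    open scoped Matrix.Norms.Operator in NormedSpace.exp_series_hasSum_exp' (𝕂 := ℝ) M
  have h2 := h.map ((Matrix.mulVecBilin ℝ ℝ).flip v : Matrix n n ℝ →ₗ[ℝ] n → ℝ)
    (LinearMap.continuous_of_finiteDimensional _)
  simpa [Function.comp_def, Matrix.smul_mulVec] using h2

theorem exp_mulVec_of_eigenvector {M : Matrix n n ℝ} {p : n → ℝ} {μ : ℝ} (h : M *ᵥ p = μ • p) :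
    NormedSpace.exp M *ᵥ p = Real.exp μ • p := by
  have hk : ∀ k : ℕ, M ^ k *ᵥ p = μ ^ k • p := by
    intro k
    induction k with
    | zero => simp
    | succ k ih => rw [pow_succ, ← Matrix.mulVec_mulVec, h, Matrix.mulVec_smul, ih, smul_smul,
        pow_succ']
  have h1 := hasSum_exp_mulVec M p
  have h2 : HasSum (fun k : ℕ => ((k.factorial : ℝ)⁻¹) • (μ ^ k)) (Real.exp μ) := by
    rw [Real.exp_eq_exp_ℝ]
    exact NormedSpace.exp_series_hasSum_exp' (𝕂 := ℝ) μ
  have h3 := h2.smul_const p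
  refine h1.unique ?_
  convert h3 using 2 with k
  rw [hk, smul_eq_mul, smul_smul]

theorem norm_exp_mulVec_le {M : Matrix n n ℝ} {c : ℝ} (hc : 0 ≤ c)
    (h : ∀ v, ‖M *ᵥ v‖ ≤ c * ‖v‖) (v : n → ℝ) :
    ‖NormedSpace.exp M *ᵥ v‖ ≤ Real.exp c * ‖v‖ := by
  have hk : ∀ k : ℕ, ‖M ^ k *ᵥ v‖ ≤ c ^ k * ‖v‖ := by
    intro k
    induction k with
    | zero => simp
    | succ k ih =>
      rw [pow_succ', ← Matrix.mulVec_mulVec]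
      calc _ ≤ c * ‖M ^ k *ᵥ v‖ := h _
        _ ≤ c * (c ^ k * ‖v‖) := by gcongr
        _ = _ := by ring
  have h2 : HasSum (fun k : ℕ => ((k.factorial : ℝ)⁻¹) • (c ^ k)) (Real.exp c) := by
    rw [Real.exp_eq_exp_ℝ]
    exact NormedSpace.exp_series_hasSum_exp' (𝕂 := ℝ) c
  rw [← (hasSum_exp_mulVec M v).tsum_eq]
  refine tsum_of_norm_bounded (h2.mul_right ‖v‖) fun k => ?_
  rw [norm_smul, norm_inv, Real.norm_natCast, smul_eq_mul, mul_assoc]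
  gcongr
  exact hk k

theorem exp_add_smul_one_mulVec (M : Matrix n n ℝ) (a : ℝ) (v : n → ℝ) :
    NormedSpace.exp (M + a • (1 : Matrix n n ℝ)) *ᵥ v
      = Real.exp a • (NormedSpace.exp M *ᵥ v) := by
  have h : NormedSpace.exp (a • (1 : Matrix n n ℝ)) *ᵥ v = Real.exp a • v :=
    exp_mulVec_of_eigenvector (by rw [Matrix.smul_mulVec, Matrix.one_mulVec])
  rw [Matrix.exp_add_of_commute _ _ ((Commute.one_right M).smul_right a),
    ← Matrix.mulVec_mulVec, h, Matrix.mulVec_smul]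

theorem continuous_exp_mulVec {α : Type*} [TopologicalSpace α] {M : α → Matrix n n ℝ}
    {v : α → n → ℝ} (hM : Continuous M) (hv : Continuous v) :
    Continuous fun s => NormedSpace.exp (M s) *ᵥ v s := by
  have h : Continuous (NormedSpace.exp : Matrix n n ℝ → Matrix n n ℝ) :=
    open scoped Matrix.Norms.Operator in NormedSpace.exp_continuous
  exact (h.comp hM).matrix_mulVec hv

theorem dotProduct_exp_mulVec {L : Matrix n n ℝ} (hL : L.IsHermitian) {p : n → ℝ} {μ : ℝ}
    (hp : L *ᵥ p = μ • p) (t : ℝ) (v : n → ℝ) :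
    p ⬝ᵥ (NormedSpace.exp (-(t • L)) *ᵥ v) = Real.exp (-(t * μ)) * (p ⬝ᵥ v) := by
  have hT : (NormedSpace.exp (-(t • L)))ᵀ = NormedSpace.exp (-(t • L)) := by
    rw [← Matrix.exp_transpose, Matrix.transpose_neg, Matrix.transpose_smul,
      ← Matrix.conjTranspose_eq_transpose_of_trivial, hL.eq]
  rw [Matrix.dotProduct_mulVec, ← Matrix.mulVec_transpose, hT,
    exp_mulVec_of_eigenvector (μ := -(t * μ)), smul_dotProduct, smul_eq_mul]
  rw [Matrix.neg_mulVec, Matrix.smul_mulVec, hp, smul_smul, neg_smul]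

omit [DecidableEq n] in
theorem dotProduct_intervalIntegral (p : n → ℝ) {f : ℝ → n → ℝ} (hf : Continuous f) (a b : ℝ) :
    p ⬝ᵥ (∫ s in a..b, f s) = ∫ s in a..b, p ⬝ᵥ f s :=
  (ContinuousLinearMap.intervalIntegral_comp_comm
    (LinearMap.toContinuousLinearMap (dotProductBilin ℝ ℝ p))
    (hf.intervalIntegrable a b)).symm

theorem dotProduct_eq_sum_eigenvectorBasis {L : Matrix n n ℝ} (hL : L.IsHermitian)
    (x y : n → ℝ) :
    x ⬝ᵥ y = ∑ k, (hL.eigenvectorBasis k ⬝ᵥ x) * (hL.eigenvectorBasis k ⬝ᵥ y) := by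
  have h := hL.eigenvectorBasis.sum_inner_mul_inner (WithLp.toLp 2 x) (WithLp.toLp 2 y)
  have h2 : inner ℝ (WithLp.toLp 2 x) (WithLp.toLp 2 y) = x ⬝ᵥ y := by
    simp [EuclideanSpace.inner_eq_star_dotProduct, dotProduct_comm]
  rw [← h2, ← h]
  refine Finset.sum_congr rfl fun k _ => ?_
  simp [EuclideanSpace.inner_eq_star_dotProduct, dotProduct_comm]

end MatrixExp


/-! ### Scalar estimates: one eigenmode, and the pointwise nonlinearity -/

theorem integral_exp_kernel {μ τ : ℝ} (hμ : 0 < μ) :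
    ∫ s in (0 : ℝ)..τ, Real.exp (-((τ - s) * μ)) = (1 - Real.exp (-(τ * μ))) / μ := by
  have h : ∀ s ∈ Set.uIcc 0 τ, HasDerivAt (fun s => Real.exp (-((τ - s) * μ)) / μ)
      (Real.exp (-((τ - s) * μ))) s := by
    intro s _
    have h1 : HasDerivAt (fun s : ℝ => -((τ - s) * μ)) μ s := by
      have := (((hasDerivAt_id' s).const_sub τ).mul_const μ).fun_neg
      simpa using this
    exact (h1.exp.div_const μ).congr_deriv (by field_simp)
  rw [intervalIntegral.integral_eq_sub_of_hasDerivAt h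
    (Continuous.intervalIntegrable (by fun_prop) _ _)]
  simp
  ring

theorem integral_exp_kernel_linear {μ τ : ℝ} (hμ : 0 < μ) (hτ : 0 < τ) :
    ∫ s in (0 : ℝ)..τ, Real.exp (-((τ - s) * μ)) * (s / τ)
      = (τ * μ - 1 + Real.exp (-(τ * μ))) / (τ * μ ^ 2) := by
  have h : ∀ s ∈ Set.uIcc 0 τ, HasDerivAt
      (fun s => Real.exp (-((τ - s) * μ)) * ((s * μ - 1) / (τ * μ ^ 2)))
      (Real.exp (-((τ - s) * μ)) * (s / τ)) s := by
    intro s _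
    have h1 : HasDerivAt (fun s : ℝ => -((τ - s) * μ)) μ s := by
      have := (((hasDerivAt_id' s).const_sub τ).mul_const μ).fun_neg
      simpa using this
    have h3 : HasDerivAt (fun s : ℝ => (s * μ - 1) / (τ * μ ^ 2)) (μ / (τ * μ ^ 2)) s := by
      have := (((hasDerivAt_id s).mul_const μ).sub_const 1).div_const (τ * μ ^ 2)
      simpa using this
    refine (h1.exp.mul h3).congr_deriv ?_
    field_simp
    ring
  rw [intervalIntegral.integral_eq_sub_of_hasDerivAt h
    (Continuous.intervalIntegrable (by fun_prop) _ _)]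
  simp
  ring

/-- The dissipation inequality for one eigenmode of the ETDRK2 scheme. -/
theorem etdrk2_mode_dissipation {μ τ u a c w v : ℝ} (hμ : 0 < μ) (hτ : 0 < τ)
    (hw : w = Real.exp (-(τ * μ)) * u + (1 - Real.exp (-(τ * μ))) / μ * a)
    (hv : v - w = (τ * μ - 1 + Real.exp (-(τ * μ))) / (τ * μ ^ 2) * (c - a)) :
    (w - u) * (μ * w - a) - 1 / 2 * ((w - u) * (μ * (w - u)))
      + ((v - w) * (μ * v - c) - 1 / 2 * ((v - w) * (μ * (v - w)))) ≤ 0 := by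
  set z := τ * μ with hz
  set e := Real.exp (-z) with he
  have hz0 : 0 < z := mul_pos hτ hμ
  have he0 : 0 < e := Real.exp_pos _
  have he1 : e * Real.exp z = 1 := by rw [he, ← Real.exp_add]; simp
  have hq : e * (1 + z + z ^ 2 / 2) ≤ 1 := by
    exact (mul_le_mul_of_nonneg_left (Real.quadratic_le_exp_of_nonneg hz0.le) he0.le).trans he1.le
  have hlin : 1 - z < e := by
    have := Real.add_one_lt_exp (x := -z) (by linarith)
    linarith
  have h1e : 0 < 1 - e := by nlinarith [mul_pos he0 hz0, mul_pos he0 (sq_pos_of_pos hz0)]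
  -- `b` and `g` eliminate `a` and `c`: `μw - a = -b(w - u)` and `c - a = g(v - w)`. With `x = w -
  -- u`, `y = v - w` the claim becomes `-b(x² + xy + y²) - (g - μ/2 - b)y² - (μ/2)x² ≤ 0`, so it
  -- suffices that `0 ≤ b ≤ 1/τ ≤ g - μ/2`.
  obtain ⟨b, hb⟩ : ∃ b, b = e * μ / (1 - e) := ⟨_, rfl⟩
  obtain ⟨g, hg⟩ : ∃ g, g = τ * μ ^ 2 / (z - 1 + e) := ⟨_, rfl⟩
  have hG : 0 < z - 1 + e := by linarith
  have hb0 : 0 ≤ b := by rw [hb]; positivity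
  have hbτ : b ≤ 1 / τ := by
    rw [hb, div_le_div_iff₀ h1e hτ]
    have : e * μ * τ = e * z := by rw [hz]; ring
    rw [this]
    nlinarith [mul_pos he0 (sq_pos_of_pos hz0)]
  have hgτ : 1 / τ + μ / 2 ≤ g := by
    rw [hg, le_div_iff₀ hG]
    -- Equivalent to `e(2 + z) ≤ z² - z + 2`, which follows on multiplying `hq` by `z² - z + 2` and
    -- dropping the nonnegative higher powers of `z`.
    have h1 : (2 + z) * (z - 1 + e) ≤ 2 * z ^ 2 := by
      have h2 : 0 ≤ z ^ 2 - z + 2 := by nlinarith [sq_nonneg (z - 1)]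
      have h3 := mul_le_mul_of_nonneg_right hq h2
      have h4 : e * (1 + z + z ^ 2 / 2) * (z ^ 2 - z + 2)
          = e * (2 + z) + e * (z ^ 2 + z ^ 3 / 2 + z ^ 4 / 2) := by ring
      have h5 : 0 ≤ e * (z ^ 2 + z ^ 3 / 2 + z ^ 4 / 2) := by positivity
      nlinarith
    have h6 : (1 / τ + μ / 2) * (z - 1 + e) = (2 + z) * (z - 1 + e) / (2 * τ) := by
      rw [hz]; field_simp
    have h7 : τ * μ ^ 2 = 2 * z ^ 2 / (2 * τ) := by rw [hz]; field_simp
    rw [h6, h7]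
    gcongr
  have hwa : μ * w - a = -b * (w - u) := by
    rw [hw, hb]; field_simp; ring
  have hca : c - a = g * (v - w) := by
    rw [hv, hg]; field_simp
  have hvc : μ * v - c = -b * (w - u) + μ * (v - w) - g * (v - w) := by
    rw [← hca, ← hwa]; ring
  rw [hwa, hvc]
  set x := w - u
  set y := v - w
  have k1 : 0 ≤ (g - μ / 2 - b) * y ^ 2 := mul_nonneg (by linarith) (sq_nonneg y)
  have k2 : 0 ≤ μ * x ^ 2 := by positivity
  have k3 : 0 ≤ b * (x ^ 2 + x * y + y ^ 2) :=
    mul_nonneg hb0 (by nlinarith [sq_nonneg (x + y), sq_nonneg x, sq_nonneg y])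
  nlinarith

/-- A Taylor bound for the double-well potential on `[-1, 1]`. -/
theorem doubleWell_sub_le {κ u w : ℝ} (hκ : 2 ≤ κ) (hu : |u| ≤ 1) (hw : |w| ≤ 1) :
    1 / 4 * (w ^ 2 - 1) ^ 2 - 1 / 4 * (u ^ 2 - 1) ^ 2
      ≤ (w - u) * (κ * w - ((κ + 1) * u - u ^ 3)) - 1 / 2 * ((w - u) * (κ * (w - u))) := by
  have hu2 := (sq_le_one_iff_abs_le_one u).2 hu
  have hw2 := (sq_le_one_iff_abs_le_one w).2 hw
  -- The subtracted bracket is the exact Taylor remainder of the well at `u` divided by `(w - u)²`;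
  -- it is at most `1 ≤ κ/2`.
  have h : 0 ≤ (w - u) ^ 2 * (κ / 2 - (3 / 4 * u ^ 2 + 1 / 2 * (u * w) + 1 / 4 * w ^ 2 - 1 / 2)) :=
    mul_nonneg (sq_nonneg _) (by nlinarith [sq_nonneg (u - w)])
  nlinarith

/-- For `κ ≥ 2` the odd function `f` increases on `[-1, 1]` and `f(1) = κ`. This is the source bound
behind the maximum principle. -/
theorem abs_nonlin_le {κ u : ℝ} (hκ : 2 ≤ κ) (hu : |u| ≤ 1) : |(κ + 1) * u - u ^ 3| ≤ κ := by
  obtain ⟨h1, h2⟩ := abs_le.1 hu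
  have key : ∀ x : ℝ, -1 ≤ x → x ≤ 1 → (κ + 1) * x - x ^ 3 ≤ κ := by
    intro x h1 h2
    -- `κ - f(x) = (κ - 2)(1 - x) + (1 - x)²(x + 2)`.
    nlinarith [mul_nonneg (sub_nonneg.2 hκ) (sub_nonneg.2 h2),
      mul_nonneg (mul_nonneg (sub_nonneg.2 h2) (sub_nonneg.2 h2)) (by linarith : 0 ≤ x + 2)]
  rw [abs_le]
  constructor
  · have := key (-u) (by linarith) (by linarith)
    linarith [this, show (-u) ^ 3 = -u ^ 3 by ring]
  · exact key u h1 h2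

/-! ### Dissipation for a symmetric positive definite matrix -/

section Dissipation

variable {n : Type*} [Fintype n] [DecidableEq n]

/-- The dissipation inequality for the ETDRK2 scheme with stages `w`, `v` and nonlinear
terms `a`, `c`. -/
theorem etdrk2_dissipation {L : Matrix n n ℝ} (hL : L.IsHermitian) {κ τ : ℝ} (hκ : 0 < κ)
    (hpos : ∀ x, κ * (x ⬝ᵥ x) ≤ x ⬝ᵥ (L *ᵥ x)) (hτ : 0 < τ) {u a c w v : n → ℝ}
    (hw : w = NormedSpace.exp (-(τ • L)) *ᵥ u
      + ∫ s in (0 : ℝ)..τ, NormedSpace.exp (-((τ - s) • L)) *ᵥ a)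
    (hv : v = NormedSpace.exp (-(τ • L)) *ᵥ u
      + ∫ s in (0 : ℝ)..τ, NormedSpace.exp (-((τ - s) • L)) *ᵥ ((1 - s / τ) • a + (s / τ) • c)) :
    (w - u) ⬝ᵥ (L *ᵥ w - a) - 1 / 2 * ((w - u) ⬝ᵥ (L *ᵥ (w - u)))
      + ((v - w) ⬝ᵥ (L *ᵥ v - c) - 1 / 2 * ((v - w) ⬝ᵥ (L *ᵥ (v - w)))) ≤ 0 := by
  set p : n → n → ℝ := fun k => hL.eigenvectorBasis k with hp
  set μ := hL.eigenvalues with hμ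
  have hev : ∀ k, L *ᵥ p k = μ k • p k := fun k => hL.mulVec_eigenvectorBasis k
  have hLx : ∀ k x, p k ⬝ᵥ (L *ᵥ x) = μ k * (p k ⬝ᵥ x) := by
    intro k x
    have hT : Lᵀ = L := by rw [← Matrix.conjTranspose_eq_transpose_of_trivial, hL.eq]
    rw [Matrix.dotProduct_mulVec, ← Matrix.mulVec_transpose, hT, hev, smul_dotProduct,
      smul_eq_mul]
  have hμpos : ∀ k, 0 < μ k := by
    intro k
    have h1 := hpos (p k)
    have h2 : p k ⬝ᵥ p k = 1 := by
      have := hL.eigenvectorBasis.inner_eq_one k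
      rwa [EuclideanSpace.inner_eq_star_dotProduct, star_trivial] at this
    rw [hLx, h2] at h1
    linarith
  have hwk : ∀ k, p k ⬝ᵥ w = Real.exp (-(τ * μ k)) * (p k ⬝ᵥ u)
      + (1 - Real.exp (-(τ * μ k))) / μ k * (p k ⬝ᵥ a) := by
    intro k
    rw [hw, dotProduct_add, dotProduct_exp_mulVec hL (hev k), dotProduct_intervalIntegral _
      (continuous_exp_mulVec (by fun_prop) continuous_const)]
    simp_rw [dotProduct_exp_mulVec hL (hev k)]
    rw [intervalIntegral.integral_mul_const, integral_exp_kernel (hμpos k)]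
  -- The propagated `u` and the constant source `a` cancel between the stages, leaving the source
  -- `(s/τ)(c - a)`.
  have hvk : ∀ k, p k ⬝ᵥ v - p k ⬝ᵥ w = (τ * μ k - 1 + Real.exp (-(τ * μ k))) / (τ * μ k ^ 2)
      * (p k ⬝ᵥ c - p k ⬝ᵥ a) := by
    intro k
    rw [hw, hv, dotProduct_add, dotProduct_add, add_sub_add_left_eq_sub,
      dotProduct_intervalIntegral _ (continuous_exp_mulVec (by fun_prop) (by fun_prop)),
      dotProduct_intervalIntegral _ (continuous_exp_mulVec (by fun_prop) continuous_const),
      ← integral_exp_kernel_linear (hμpos k) hτ, ← intervalIntegral.integral_mul_const]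
    simp_rw [dotProduct_exp_mulVec hL (hev k)]
    rw [← intervalIntegral.integral_sub
      (Continuous.intervalIntegrable (by simp only [dotProduct_add, dotProduct_smul]; fun_prop) _ _)
      (Continuous.intervalIntegrable (by fun_prop) _ _)]
    refine intervalIntegral.integral_congr fun s _ => ?_
    simp only [dotProduct_add, dotProduct_smul, smul_eq_mul]
    ring
  have hpars : ∀ x y : n → ℝ, x ⬝ᵥ y = ∑ k, (p k ⬝ᵥ x) * (p k ⬝ᵥ y) :=
    dotProduct_eq_sum_eigenvectorBasis hL
  rw [hpars (w - u) (L *ᵥ w - a), hpars (w - u) (L *ᵥ (w - u)), hpars (v - w) (L *ᵥ v - c),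
    hpars (v - w) (L *ᵥ (v - w)), Finset.mul_sum, Finset.mul_sum, ← Finset.sum_sub_distrib,
    ← Finset.sum_sub_distrib, ← Finset.sum_add_distrib]
  refine Finset.sum_nonpos fun k _ => ?_
  have := etdrk2_mode_dissipation (hμpos k) hτ (hwk k) (hvk k)
  simpa only [dotProduct_sub, hLx] using this

end Dissipation

end NAC

namespace NAC

/-! ### Symmetry, sign and maximum-norm contraction for the discrete operator -/

section DiscreteOperator

variable {d : ℕ} {N : ℕ} [NeZero N] {δ h : ℝ} {ρ : ℝ → ℝ}

theorem norm1_nonneg (s : E d) : 0 ≤ norm1 s := Finset.sum_nonneg fun _ _ => abs_nonneg _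

theorem beta_nonneg (hρ : IsKernel d δ ρ) (h : ℝ) (j : Fin d → ℤ) : 0 ≤ beta δ ρ h j := by
  refine mul_nonneg (by norm_num) (setIntegral_nonneg Metric.isOpen_ball.measurableSet ?_)
  intro s hs
  have h1 : 0 ≤ ρ ‖s‖ := hρ.nonneg _ ⟨norm_nonneg _, (mem_ball_zero_iff.1 hs).le⟩
  have h2 : 0 ≤ hat h j s := Finset.prod_nonneg fun _ _ => le_max_left _ _
  have h3 := norm1_nonneg s
  positivity

/-- The coefficient `‖s_j‖₁ β_δ(s_j) / |s_j|²` of the difference operator. -/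
noncomputable def opWeight (δ : ℝ) (ρ : ℝ → ℝ) (h : ℝ) (j : Fin d → ℤ) : ℝ :=
  norm1 (node h j : E d) * beta δ ρ h j / ‖(node h j : E d)‖ ^ 2

theorem opWeight_nonneg (hρ : IsKernel d δ ρ) (h : ℝ) (j : Fin d → ℤ) :
    0 ≤ opWeight δ ρ h j :=
  div_nonneg (mul_nonneg (norm1_nonneg _) (beta_nonneg hρ h j)) (sq_nonneg _)

theorem stiffness_mulVec (U : Idx d N → ℝ) (i : Idx d N) :
    (stiffness N δ ρ h *ᵥ U) i = ∑ j ∈ stencil d δ h, opWeight δ ρ h j *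
      (U (i + fun k => (j k : ZMod N)) + U (i - fun k => (j k : ZMod N)) - 2 * U i) := by
  rw [stiffness, LinearMap.toMatrix'_mulVec]
  refine Finset.sum_congr rfl fun j _ => ?_
  rw [opWeight]
  ring

/-- Summation by parts, without boundary terms because translation permutes the group. The right
side is symmetric in `x`, `y`, which gives both symmetry and, with nonnegative weights, the sign of
`D_h`. -/
theorem sum_mul_second_difference {G : Type*} [AddCommGroup G] [Fintype G] (x y : G → ℝ) (a : G) :
    ∑ i, x i * (y (i + a) + y (i - a) - 2 * y i)
      = -∑ i, (x (i + a) - x i) * (y (i + a) - y i) := by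
  have h1 : ∑ i, x (i + a) * y i = ∑ i, x i * y (i - a) := by
    rw [← Equiv.sum_comp (Equiv.subRight a)]
    simp
  have h2 : ∑ i, x (i + a) * y (i + a) = ∑ i, x i * y i :=
    Equiv.sum_comp (Equiv.addRight a) fun i => x i * y i
  simp only [sub_mul, mul_sub, mul_add, Finset.sum_sub_distrib, Finset.sum_add_distrib, h1, h2,
    mul_left_comm _ (2 : ℝ), ← Finset.mul_sum]
  ring

theorem dotProduct_stiffness_mulVec (x y : Idx d N → ℝ) :
    x ⬝ᵥ (stiffness N δ ρ h *ᵥ y) = -∑ j ∈ stencil d δ h, opWeight δ ρ h j *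
      ∑ i, (x (i + fun k => (j k : ZMod N)) - x i) * (y (i + fun k => (j k : ZMod N)) - y i) := by
  simp only [dotProduct, stiffness_mulVec, Finset.mul_sum]
  rw [Finset.sum_comm, ← Finset.sum_neg_distrib]
  refine Finset.sum_congr rfl fun j _ => ?_
  rw [← Finset.mul_sum, ← mul_neg, ← sum_mul_second_difference, Finset.mul_sum]
  exact Finset.sum_congr rfl fun i _ => by ring

theorem dotProduct_stiffness_mulVec_comm (x y : Idx d N → ℝ) :
    x ⬝ᵥ (stiffness N δ ρ h *ᵥ y) = y ⬝ᵥ (stiffness N δ ρ h *ᵥ x) := by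
  simp only [dotProduct_stiffness_mulVec, mul_comm]

theorem dotProduct_stiffness_mulVec_self_nonpos (hρ : IsKernel d δ ρ) (x : Idx d N → ℝ) :
    x ⬝ᵥ (stiffness N δ ρ h *ᵥ x) ≤ 0 := by
  rw [dotProduct_stiffness_mulVec, neg_nonpos]
  exact Finset.sum_nonneg fun j _ => mul_nonneg (opWeight_nonneg hρ h j)
    (Finset.sum_nonneg fun i _ => mul_self_nonneg _)

theorem stiffness_isHermitian : (stiffness (d := d) N δ ρ h).IsHermitian := by
  refine Matrix.IsHermitian.ext fun i j => ?_
  have := dotProduct_stiffness_mulVec_comm (δ := δ) (ρ := ρ) (h := h)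
    (Pi.single j 1 : Idx d N → ℝ) (Pi.single i 1)
  simpa using this

variable {ε κ : ℝ}

theorem Lh_isHermitian : (Lh (d := d) N ε κ δ ρ h).IsHermitian := by
  have h1 := (stiffness_isHermitian (d := d) (N := N) (δ := δ) (ρ := ρ) (h := h)).eq
  rw [Matrix.IsHermitian, Lh, Matrix.conjTranspose_add, Matrix.conjTranspose_neg,
    Matrix.conjTranspose_smul, Matrix.conjTranspose_smul, h1, Matrix.conjTranspose_one]
  simp

theorem Lh_mulVec (x : Idx d N → ℝ) :
    Lh N ε κ δ ρ h *ᵥ x = κ • x - ε ^ 2 • (stiffness N δ ρ h *ᵥ x) := by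
  rw [Lh, Matrix.add_mulVec, Matrix.neg_mulVec, Matrix.smul_mulVec, Matrix.smul_mulVec,
    Matrix.one_mulVec]
  abel

theorem le_dotProduct_Lh_mulVec_self (hρ : IsKernel d δ ρ) (x : Idx d N → ℝ) :
    κ * (x ⬝ᵥ x) ≤ x ⬝ᵥ (Lh N ε κ δ ρ h *ᵥ x) := by
  rw [Lh_mulVec, dotProduct_sub, dotProduct_smul, dotProduct_smul, smul_eq_mul, smul_eq_mul]
  nlinarith [mul_nonneg (sq_nonneg ε)
    (neg_nonneg.2 (dotProduct_stiffness_mulVec_self_nonpos (h := h) hρ x))]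

/-- The contraction property of `e^{-tL_h}` in the maximum norm. -/
theorem norm_exp_Lh_mulVec_le (hρ : IsKernel d δ ρ) {t : ℝ} (ht : 0 ≤ t) (v : Idx d N → ℝ) :
    ‖NormedSpace.exp (-(t • Lh N ε κ δ ρ h)) *ᵥ v‖ ≤ Real.exp (-(t * κ)) * ‖v‖ := by
  -- The shift by `c` cancels the `-2U_i` terms: `D_h + cI` has only nonnegative coefficients, with
  -- total `c` in each row. Its exponential grows by at most `e^{tε²c}`, which the scalar factor
  -- split off in `hsplit` removes, leaving `e^{-tκ}`.
  set c := 2 * ∑ j ∈ stencil d δ h, opWeight δ ρ h j with hc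
  have hw := opWeight_nonneg hρ h
  have hc0 : 0 ≤ c := mul_nonneg two_pos.le (Finset.sum_nonneg fun j _ => hw j)
  set M := (t * ε ^ 2) • (stiffness N δ ρ h + c • (1 : Matrix (Idx d N) (Idx d N) ℝ)) with hM
  have hsplit : -(t • Lh N ε κ δ ρ h)
      = M + (-(t * κ) - t * ε ^ 2 * c) • (1 : Matrix (Idx d N) (Idx d N) ℝ) := by
    rw [hM, Lh]
    module
  have hbound : ∀ x, ‖M *ᵥ x‖ ≤ (t * ε ^ 2 * c) * ‖x‖ := by
    intro x
    have h1 : ‖(stiffness N δ ρ h + c • (1 : Matrix (Idx d N) (Idx d N) ℝ)) *ᵥ x‖ ≤ c * ‖x‖ := by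
      refine (pi_norm_le_iff_of_nonneg (by positivity)).2 fun i => ?_
      have h2 : ((stiffness N δ ρ h + c • (1 : Matrix (Idx d N) (Idx d N) ℝ)) *ᵥ x) i
          = ∑ j ∈ stencil d δ h, opWeight δ ρ h j *
            (x (i + fun k => (j k : ZMod N)) + x (i - fun k => (j k : ZMod N))) := by
        rw [Matrix.add_mulVec, Matrix.smul_mulVec, Matrix.one_mulVec, Pi.add_apply,
          Pi.smul_apply, stiffness_mulVec, smul_eq_mul, hc, mul_assoc, Finset.sum_mul, Finset.mul_sum, ← Finset.sum_add_distrib]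
        exact Finset.sum_congr rfl fun j _ => by ring
      rw [h2, hc, mul_assoc, Finset.sum_mul, Finset.mul_sum]
      refine norm_sum_le_of_le _ fun j _ => ?_
      rw [norm_mul, Real.norm_of_nonneg (hw j)]
      have h3 := norm_add_le_of_le (norm_le_pi_norm x (i + fun k => (j k : ZMod N)))
        (norm_le_pi_norm x (i - fun k => (j k : ZMod N)))
      linarith [mul_le_mul_of_nonneg_left h3 (hw j)]
    rw [hM, Matrix.smul_mulVec, norm_smul, Real.norm_of_nonneg (by positivity),
      mul_assoc (t * ε ^ 2) c]
    gcongr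
  rw [hsplit, exp_add_smul_one_mulVec, norm_smul, Real.norm_of_nonneg (Real.exp_pos _).le,
    Real.exp_sub, div_mul_eq_mul_div, div_le_iff₀ (Real.exp_pos _), mul_assoc, mul_comm ‖v‖]
  gcongr
  exact norm_exp_mulVec_le (by positivity) hbound v

end DiscreteOperator

/-! ### Maximum principle and energy decay for the scheme -/

section Scheme

variable {d : ℕ} {N : ℕ} [NeZero N] {ε κ δ h τ : ℝ} {ρ : ℝ → ℝ}

/-- One exponential time step with data bounded by `1` and source bounded by `κ` stays in the
unit ball of the maximum norm. -/
theorem norm_exp_step_le_one (hρ : IsKernel d δ ρ) (hκ : 0 < κ) (hτ : 0 ≤ τ)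
    {U : Idx d N → ℝ} (hU : ‖U‖ ≤ 1) {g : ℝ → Idx d N → ℝ}
    (hgκ : ∀ s ∈ Set.Icc 0 τ, ‖g s‖ ≤ κ) :
    ‖NormedSpace.exp (-(τ • Lh N ε κ δ ρ h)) *ᵥ U
      + ∫ s in (0 : ℝ)..τ, NormedSpace.exp (-((τ - s) • Lh N ε κ δ ρ h)) *ᵥ g s‖ ≤ 1 := by
  have h1 : ‖NormedSpace.exp (-(τ • Lh N ε κ δ ρ h)) *ᵥ U‖ ≤ Real.exp (-(τ * κ)) :=
    (norm_exp_Lh_mulVec_le hρ hτ U).trans (mul_le_of_le_one_right (Real.exp_pos _).le hU)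
  have h2 : ‖∫ s in (0 : ℝ)..τ, NormedSpace.exp (-((τ - s) • Lh N ε κ δ ρ h)) *ᵥ g s‖
      ≤ ∫ s in (0 : ℝ)..τ, Real.exp (-((τ - s) * κ)) * κ := by
    refine intervalIntegral.norm_integral_le_of_norm_le hτ (Filter.Eventually.of_forall ?_)
      (Continuous.intervalIntegrable (by fun_prop) _ _)
    intro s hs
    refine (norm_exp_Lh_mulVec_le hρ (sub_nonneg.2 hs.2) _).trans ?_
    gcongr
    exact hgκ s ⟨hs.1.le, hs.2⟩
  -- The two contributions are `e^{-τκ}` and `1 - e^{-τκ}`, summing to exactly 1.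
  rw [intervalIntegral.integral_mul_const, integral_exp_kernel hκ, div_mul_cancel₀ _ hκ.ne'] at h2
  linarith [norm_add_le_of_le h1 h2]

theorem norm_nonlin_le (hκ : 2 ≤ κ) {U : Idx d N → ℝ} (hU : ‖U‖ ≤ 1) : ‖nonlin κ U‖ ≤ κ :=
  (pi_norm_le_iff_of_nonneg (by linarith)).2 fun i =>
    abs_nonlin_le hκ ((norm_le_pi_norm U i).trans hU)

theorem norm_stage1_le_one (hρ : IsKernel d δ ρ) (hκ : 2 ≤ κ) (hτ : 0 ≤ τ)
    {U : Idx d N → ℝ} (hU : ‖U‖ ≤ 1) : ‖stage1 κ τ (Lh N ε κ δ ρ h) U‖ ≤ 1 :=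
  norm_exp_step_le_one hρ (by linarith) hτ hU fun _ _ => norm_nonlin_le hκ hU

/-- The discrete maximum principle for the ETDRK2 scheme. -/
theorem norm_etdrk2Step_le_one (hρ : IsKernel d δ ρ) (hκ : 2 ≤ κ) (hτ : 0 < τ)
    {U : Idx d N → ℝ} (hU : ‖U‖ ≤ 1) : ‖etdrk2Step κ τ (Lh N ε κ δ ρ h) U‖ ≤ 1 := by
  refine norm_exp_step_le_one hρ (by linarith) hτ.le hU fun s hs => ?_
  have h0 : 0 ≤ s / τ := div_nonneg hs.1 hτ.le
  have h1 : 0 ≤ 1 - s / τ := sub_nonneg.2 ((div_le_one hτ).2 hs.2)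
  have h2 := norm_nonlin_le hκ hU
  have h3 := norm_nonlin_le hκ (norm_stage1_le_one (ε := ε) (h := h) hρ hκ hτ.le hU)
  refine (norm_add_le _ _).trans ?_
  rw [norm_smul, norm_smul, Real.norm_of_nonneg h0, Real.norm_of_nonneg h1]
  nlinarith [mul_le_mul_of_nonneg_left h2 h1, mul_le_mul_of_nonneg_left h3 h0]

/-- The well is estimated node by node with `doubleWell_sub_le`. The nonlocal part is expanded about
`W` rather than `U`; being quadratic it gives equality, by symmetry of `D_h`. -/
theorem energy_sub_le (hκ : 2 ≤ κ) {U W : Idx d N → ℝ} (hU : ‖U‖ ≤ 1) (hW : ‖W‖ ≤ 1) :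
    energy ε δ ρ h W - energy ε δ ρ h U ≤ (W - U) ⬝ᵥ (Lh N ε κ δ ρ h *ᵥ W - nonlin κ U)
      - 1 / 2 * ((W - U) ⬝ᵥ (Lh N ε κ δ ρ h *ᵥ (W - U))) := by
  have hpot : 1 / 4 * ∑ i, (W i ^ 2 - 1) ^ 2 - 1 / 4 * ∑ i, (U i ^ 2 - 1) ^ 2
      ≤ (W - U) ⬝ᵥ (κ • W - nonlin κ U) - 1 / 2 * ((W - U) ⬝ᵥ (κ • (W - U))) := by
    simp only [dotProduct, Finset.mul_sum, ← Finset.sum_sub_distrib]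
    exact Finset.sum_le_sum fun i _ => doubleWell_sub_le hκ ((norm_le_pi_norm U i).trans hU)
      ((norm_le_pi_norm W i).trans hW)
  have hsymm := dotProduct_stiffness_mulVec_comm (δ := δ) (ρ := ρ) (h := h) U W
  simp only [energy, Lh_mulVec, dotProduct_sub, sub_dotProduct, dotProduct_smul, smul_eq_mul,
    Matrix.mulVec_sub, smul_sub] at hpot ⊢
  linear_combination hpot - ε ^ 2 / 2 * hsymm

/-- The ETDRK2 scheme is unconditionally energy decreasing. -/
theorem energy_etdrk2Step_le (hρ : IsKernel d δ ρ) (hκ : 2 ≤ κ) (hτ : 0 < τ)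
    {U : Idx d N → ℝ} (hU : ‖U‖ ≤ 1) :
    energy ε δ ρ h (etdrk2Step κ τ (Lh N ε κ δ ρ h) U) ≤ energy ε δ ρ h U := by
  have hW := norm_stage1_le_one (ε := ε) (h := h) hρ hκ hτ.le hU
  have hV := norm_etdrk2Step_le_one (ε := ε) (h := h) hρ hκ hτ hU
  have h1 := energy_sub_le (ε := ε) (δ := δ) (ρ := ρ) (h := h) hκ hU hW
  have h2 := energy_sub_le (ε := ε) (δ := δ) (ρ := ρ) (h := h) hκ hW hV
  have h3 := etdrk2_dissipation (L := Lh N ε κ δ ρ h) Lh_isHermitian (by linarith : 0 < κ)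
    (le_dotProduct_Lh_mulVec_self hρ) hτ (u := U) (a := nonlin κ U)
    (c := nonlin κ (stage1 κ τ (Lh N ε κ δ ρ h) U)) rfl rfl
  rw [← stage1, ← etdrk2Step] at h3
  linarith

theorem norm_restrict_le_one {X : ℝ} (hX : 0 < X) {u₀ : E d → ℝ}
    (hu₀ : ∀ x ∈ OmegaBar d X, |u₀ x| ≤ 1) : ‖restrict N (X / N) u₀‖ ≤ 1 := by
  refine (pi_norm_le_iff_of_nonneg zero_le_one).2 fun i => hu₀ _ fun k => ?_
  have hN : (0 : ℝ) < N := Nat.cast_pos.2 (NeZero.pos N)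
  have h1 : (((i k).val : ℕ) : ℝ) ≤ N := Nat.cast_le.2 (ZMod.val_lt _).le
  simp only [node, Int.cast_natCast]
  refine ⟨by positivity, ?_⟩
  rw [div_mul_eq_mul_div, div_le_iff₀ hN]
  gcongr

theorem IsETDRK2.norm_le_one {X : ℝ} (hX : 0 < X) {u₀ : E d → ℝ}
    (hu₀ : ∀ x ∈ OmegaBar d X, |u₀ x| ≤ 1) (hρ : IsKernel d δ ρ) (hκ : 2 ≤ κ) (hτ : 0 < τ)
    (hh : h = X / N) {K : ℕ} {U : ℕ → Idx d N → ℝ} (hU : IsETDRK2 ε κ δ ρ h τ K u₀ U) :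
    ∀ n ≤ K, ‖U n‖ ≤ 1 := by
  intro n
  induction n with
  | zero => intro _; rw [hU.init, hh]; exact norm_restrict_le_one hX hu₀
  | succ n ih =>
    intro hn
    rw [hU.step n hn]
    exact norm_etdrk2Step_le_one hρ hκ hτ (ih (Nat.le_of_succ_le hn))

theorem IsETDRK2.energy_succ_le {X : ℝ} (hX : 0 < X) {u₀ : E d → ℝ}
    (hu₀ : ∀ x ∈ OmegaBar d X, |u₀ x| ≤ 1) (hρ : IsKernel d δ ρ) (hκ : 2 ≤ κ) (hτ : 0 < τ)
    (hh : h = X / N) {K : ℕ} {U : ℕ → Idx d N → ℝ} (hU : IsETDRK2 ε κ δ ρ h τ K u₀ U)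
    {n : ℕ} (hn : n < K) : energy ε δ ρ h (U (n + 1)) ≤ energy ε δ ρ h (U n) := by
  rw [hU.step n hn]
  exact energy_etdrk2Step_le hρ hκ hτ (hU.norm_le_one hX hu₀ hρ hκ hτ hh n hn.le)

end Scheme

end NAC

theorem mainTheorem7 (d : ℕ) (hd : 1 ≤ d) (X T ε κ δ : ℝ) [Fact (0 < X)] (hT : 0 < T)
    (hε : 0 < ε) (hκ : 2 ≤ κ) (hδ : 0 < δ) (ρ : ℝ → ℝ) (hρ : NAC.IsKernel d δ ρ)
    (u₀ : NAC.E d → ℝ) (u : ℝ → NAC.CPer4 d X) (hsol : NAC.IsNACSolution T ε δ ρ u₀ u)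
    (hreg : ContDiffOn ℝ 2 u (Set.Icc 0 T)) (hu₀ : ∀ x ∈ NAC.OmegaBar d X, |u₀ x| ≤ 1) :
    (∃ C : ℝ, 0 < C ∧ ∀ (N : ℕ) [NeZero N] (K : ℕ) (h τ : ℝ) (U : ℕ → NAC.Idx d N → ℝ),
      h = X / (N : ℝ) → 0 < K → τ = T / (K : ℝ) → τ ≤ 1 →
      NAC.IsETDRK2 ε κ δ ρ h τ K u₀ U → ∀ n < K,
        NAC.energy ε δ ρ h (U (n + 1)) ≤
          NAC.energy ε δ ρ h (U n) + C * h ^ (-(1 / 2) : ℝ) * (h ^ 2 + τ) ^ 2) ∧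
    (∀ lam : ℝ, 0 < lam → ∃ C' : ℝ, 0 < C' ∧
      ∀ (N : ℕ) [NeZero N] (K : ℕ) (h τ : ℝ) (U : ℕ → NAC.Idx d N → ℝ),
      h = X / (N : ℝ) → 0 < K → τ = T / (K : ℝ) → h ≤ 1 → τ = lam * √h →
      NAC.IsETDRK2 ε κ δ ρ h τ K u₀ U → ∀ n ≤ K,
        NAC.energy ε δ ρ h (U n) ≤ NAC.energy ε δ ρ h (U 0) + C') := by
  have hX : 0 < X := Fact.out
  refine ⟨⟨1, one_pos, ?_⟩, fun lam _ => ⟨1, one_pos, ?_⟩⟩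
  · intro N _ K h τ U hh hK hτ _ hU n hn
    have hτ0 : 0 < τ := by rw [hτ]; positivity
    have hh0 : 0 ≤ h := by rw [hh]; positivity
    have hrem : 0 ≤ 1 * h ^ (-(1 / 2) : ℝ) * (h ^ 2 + τ) ^ 2 := by positivity
    linarith [hU.energy_succ_le hX hu₀ hρ hκ hτ0 hh hn]
  · intro N _ K h τ U hh hK hτ _ _ hU n hn
    have hτ0 : 0 < τ := by rw [hτ]; positivity
    have hmono : ∀ m ≤ K, NAC.energy ε δ ρ h (U m) ≤ NAC.energy ε δ ρ h (U 0) := by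
      intro m
      induction m with
      | zero => exact fun _ => le_rfl
      | succ m ih =>
        exact fun hm => (hU.energy_succ_le hX hu₀ hρ hκ hτ0 hh hm).trans
          (ih (Nat.le_of_succ_le hm))
    linarith [hmono n hn]
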